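/- Let $(S,\mathfrak m,k)$ and $(T,\mathfrak n,k)$ be commutative Noetherian local rings with common residue field $k$, and let $\pi_S\colon S\twoheadrightarrow k$ and $\pi_T\colon T\twoheadrightarrow k$ be the natural surjections. Assume that neither $S$ nor $T$ is a field, and let $$R = S\times_k T=\{(s,t)\in S\times T : \pi_S(s)=\pi_T(t)\}$$ be the fiber product ring. A finitely generated $R$-module $M$ is called torsionless if the canonical biduality map $M\to M^{**}$ is injective, where $(-)^*=\operatorname{Hom}_R(-,R)$. Suppose that neither $S$ nor $T$ is a discrete valuation ring, and let $M$ and $N$ be finitely generated torsionless $R$-modules. If $\operatorname{Tor}^R_4(M,N)=0$, then at least one of $M$ and $N$ has projective dimension at most one over $R$. -/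

import Mathlib

open CategoryTheory

universe u v

/-- A finitely generated module `M` over a commutative Noetherian ring `A` is *torsionless* if the
canonical biduality map `M → M**` is injective. (Finite generation and Noetherianity are supplied
as separate hypotheses where the notion is used.) -/
def IsTorsionless (A : Type*) [CommRing A] (M : Type*) [AddCommGroup M] [Module A M] : Prop :=
  Function.Injective (Module.Dual.eval A M)

/-- `A` is a discrete valuation ring (in particular a domain). -/
def IsDVR (A : Type*) [CommRing A] : Prop :=
  ∃ _ : IsDomain A, IsDiscreteValuationRing A

open IsLocalRing TensorProduct

/-! ### Minimal free covers and minimal generators over a local ring. -/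

section MinimalCovers

variable {R : Type*} [CommRing R] [IsLocalRing R]

/-! The maximal ideal of `R` is `I ⊕ J`, with `I` and `J` copies of those of `S` and `T`, so `I * J
= 0`. In fact `M` or `N` turns out to be projective.

Suppose neither is. The first syzygy of a torsionless module splits into a part with coordinates in
`I` and one with coordinates in `J` (`ker_split`), so `ΩM` and `ΩN` each have a minimal generator on
one side (`exists_generator`). The generator of `ΩM` is killed by the opposite ideal. As neither `S`
nor `T` is a DVR, two syzygies later `Ω³M` has minimal generators on both sides
(`exists_second_syzygy_generators`).

Choose a minimal generator `x` of `Ω³M` on the side opposite to the generator `v` of `ΩN`. Then `x ⊗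
v` vanishes in the tensor product of the free covers, because `I * J = 0`. But `Tor₄(M, N) =
Tor₁(Ω³M, N) = 0` makes `Ω³M ⊗ ΩN` embed there, and a tensor of minimal generators is nonzero over a
local ring. -/

theorem Submodule.eq_bot_of_le_maximalIdeal_smul {M : Type*} [AddCommGroup M] [Module R M]
    {N : Submodule R M} (hN : N.FG) (h : N ≤ maximalIdeal R • N) : N = ⊥ :=
  Submodule.eq_bot_of_le_smul_of_le_jacobson_bot _ N hN h
    (IsLocalRing.maximalIdeal_le_jacobson _)

/-- A functional to the residue field detecting elements outside `𝔪 M`. -/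
theorem exists_residueField_functional {M : Type*} [AddCommGroup M] [Module R M] {x : M}
    (hx : x ∉ maximalIdeal R • (⊤ : Submodule R M)) :
    ∃ φ : M →ₗ[R] R ⧸ maximalIdeal R, φ x ≠ 0 := by
  let _ := Ideal.Quotient.field (maximalIdeal R)
  have h0 : Submodule.Quotient.mk (p := maximalIdeal R • (⊤ : Submodule R M)) x ≠ 0 := by
    simpa using hx
  obtain ⟨f, hf⟩ : ∃ f : Module.Dual (R ⧸ maximalIdeal R) (M ⧸ maximalIdeal R • (⊤ : Submodule R M)),
      f (Submodule.Quotient.mk x) ≠ 0 := by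
    by_contra! h
    exact h0 ((Module.forall_dual_apply_eq_zero_iff (R ⧸ maximalIdeal R) _).mp h)
  exact ⟨(f.restrictScalars R).comp (Submodule.mkQ _), hf⟩

/-- Functionals to the residue field multiply to a map on the tensor product, and a field has no
zero divisors. -/
theorem tmul_ne_zero_of_notMem_maximalIdeal_smul {M N : Type*} [AddCommGroup M] [Module R M]
    [AddCommGroup N] [Module R N] {x : M} {y : N}
    (hx : x ∉ maximalIdeal R • (⊤ : Submodule R M))
    (hy : y ∉ maximalIdeal R • (⊤ : Submodule R N)) : x ⊗ₜ[R] y ≠ 0 := by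
  obtain ⟨φ, hφ⟩ := exists_residueField_functional hx
  obtain ⟨ψ, hψ⟩ := exists_residueField_functional hy
  intro h
  have := congrArg (LinearMap.mul' R (R ⧸ maximalIdeal R) ∘ₗ TensorProduct.map φ ψ) h
  simp at this
  tauto

theorem Submodule.mk_notMem_smul_top {A M : Type*} [CommRing A] [AddCommGroup M] [Module A M]
    {N : Submodule A M} {I : Ideal A} {x : M} (hx : x ∈ N) (h : x ∉ I • N) :
    (⟨x, hx⟩ : N) ∉ I • (⊤ : Submodule A N) := by
  intro hmem
  apply h
  have := Submodule.mem_map_of_mem (f := N.subtype) hmem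
  rwa [Submodule.map_smul'', Submodule.map_top, Submodule.range_subtype] at this

/-- A surjection from a finite free module whose kernel is contained in `𝔪 Rⁿ`. -/
structure IsMinimalCover {n : ℕ} {M : Type*} [AddCommGroup M] [Module R M]
    (f : (Fin n → R) →ₗ[R] M) : Prop where
  surjective : Function.Surjective f
  mem_maximalIdeal : ∀ c, f c = 0 → ∀ i, c i ∈ maximalIdeal R

-- Lift a basis of `M / 𝔪M`: Nakayama gives surjectivity, linear independence puts the kernel in
-- `𝔪Rⁿ`.
variable (R) in
theorem exists_isMinimalCover (M : Type*) [AddCommGroup M] [Module R M] [Module.Finite R M] :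
    ∃ (n : ℕ) (f : (Fin n → R) →ₗ[R] M), IsMinimalCover f := by
  let _ := Ideal.Quotient.field (maximalIdeal R)
  have : Module.Finite (R ⧸ maximalIdeal R) (M ⧸ maximalIdeal R • (⊤ : Submodule R M)) :=
    Module.Finite.of_restrictScalars_finite R _ _
  let b := Module.finBasis (R ⧸ maximalIdeal R) (M ⧸ maximalIdeal R • (⊤ : Submodule R M))
  choose x hx using fun i => Submodule.mkQ_surjective _ (b i)
  let f := Fintype.linearCombination R x
  have hf : ∀ c, Submodule.mkQ _ (f c) = ∑ i, Ideal.Quotient.mk (maximalIdeal R) (c i) • b i := by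
    intro c
    simp only [f, Fintype.linearCombination_apply, map_sum, map_smul, hx]
    rfl
  refine ⟨_, f, ?_, ?_⟩
  · rw [← LinearMap.range_eq_top, eq_top_iff]
    refine Submodule.le_of_le_smul_of_le_jacobson_bot (I := maximalIdeal R)
      Module.Finite.fg_top (IsLocalRing.maximalIdeal_le_jacobson _) ?_
    intro y _
    choose c hc using fun i => Ideal.Quotient.mk_surjective (b.repr (Submodule.mkQ _ y) i)
    have : Submodule.mkQ (maximalIdeal R • (⊤ : Submodule R M)) (y - f c) = 0 := by
      rw [map_sub, hf]
      simp only [hc, b.sum_repr, sub_self]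
    rw [Submodule.mkQ_apply, Submodule.Quotient.mk_eq_zero] at this
    rw [← sub_add_cancel y (f c), add_comm]
    exact Submodule.add_mem_sup ⟨c, rfl⟩ this
  · intro c hc i
    have h0 : ∑ i, Ideal.Quotient.mk (maximalIdeal R) (c i) • b i = 0 := by
      rw [← hf, hc, map_zero]
    rw [← Ideal.Quotient.eq_zero_iff_mem]
    exact (Fintype.linearIndependent_iff.mp b.linearIndependent) _ h0 i

theorem Pi.single_eq_smul_single_one {A : Type*} [CommRing A] {n : ℕ} (i : Fin n) (r : A) :
    (Pi.single i r : Fin n → A) = r • Pi.single i 1 := by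
  rw [← Pi.single_smul, smul_eq_mul, mul_one]

theorem exists_isUnit_of_map_notMem_smul {n : ℕ} {M : Type*} [AddCommGroup M] [Module R M]
    {f : (Fin n → R) →ₗ[R] M} {c : Fin n → R}
    (hc : f c ∉ maximalIdeal R • (⊤ : Submodule R M)) : ∃ i, IsUnit (c i) := by
  by_contra! h
  apply hc
  rw [← Finset.univ_sum_single c, map_sum]
  refine Submodule.sum_mem _ fun i _ => ?_
  rw [Pi.single_eq_smul_single_one, map_smul]
  exact Submodule.smul_mem_smul ((IsLocalRing.mem_maximalIdeal _).mpr (h i)) trivial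

theorem coord_mem_of_mem_smul {A : Type*} [CommRing A] {n : ℕ} {I J : Ideal A}
    {N : Submodule A (Fin n → A)}
    (hN : ∀ c ∈ N, ∀ i, c i ∈ J) {c : Fin n → A} (hc : c ∈ I • N) (i : Fin n) : c i ∈ I * J := by
  have := Submodule.mem_map_of_mem (f := LinearMap.proj (R := A) (φ := fun _ => A) i) hc
  rw [Submodule.map_smul''] at this
  refine Submodule.smul_mono le_rfl ?_ this
  rintro _ ⟨d, hd, rfl⟩
  exact hN d hd i

end MinimalCovers

/-! ### Syzygies over a local ring with decomposable maximal ideal. -/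

section DecomposableMaximalIdeal

variable {R : Type*} [CommRing R] [IsLocalRing R] [IsNoetherianRing R]

/-- The maximal ideal is the direct sum of two nonzero ideals. -/
structure IsDecomposition (I J : Ideal R) : Prop where
  inf_eq_bot : I ⊓ J = ⊥
  sup_eq : I ⊔ J = maximalIdeal R
  left_ne_bot : I ≠ ⊥
  right_ne_bot : J ≠ ⊥

namespace IsDecomposition

variable {I J : Ideal R}

omit [IsNoetherianRing R] in
theorem symm (h : IsDecomposition I J) : IsDecomposition J I :=
  ⟨inf_comm I J ▸ h.inf_eq_bot, sup_comm I J ▸ h.sup_eq, h.right_ne_bot, h.left_ne_bot⟩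

omit [IsNoetherianRing R] in
theorem eq_zero (h : IsDecomposition I J) {x : R} (hI : x ∈ I) (hJ : x ∈ J) : x = 0 := by
  rw [← Ideal.mem_bot, ← h.inf_eq_bot]
  exact ⟨hI, hJ⟩

omit [IsNoetherianRing R] in
theorem mul_eq_zero (h : IsDecomposition I J) {x y : R} (hx : x ∈ I) (hy : y ∈ J) : x * y = 0 :=
  h.eq_zero (I.mul_mem_right _ hx) (J.mul_mem_left _ hy)

/-- If `J ≤ 𝔪² = I𝔪 + J𝔪`, directness of the sum forces `J ≤ 𝔪J`, and Nakayama gives `J = 0`. -/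
theorem exists_notMem_sq (h : IsDecomposition I J) :
    ∃ j ∈ J, j ∉ maximalIdeal R * maximalIdeal R := by
  by_contra! H
  apply h.right_ne_bot
  have hle : J ≤ maximalIdeal R * J := by
    intro j hj
    have h2 : j ∈ I * maximalIdeal R ⊔ J * maximalIdeal R := by
      rw [← Ideal.sup_mul, h.sup_eq]
      exact H j hj
    obtain ⟨a, ha, b, hb, hab⟩ := Submodule.mem_sup.mp h2
    have hb' : b ∈ J := (Ideal.mul_le_left : J * maximalIdeal R ≤ J) hb
    have ha' : a ∈ I := (Ideal.mul_le_left : I * maximalIdeal R ≤ I) ha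
    have haJ : a ∈ J := eq_sub_of_add_eq hab ▸ J.sub_mem hj hb'
    have ha0 : a = 0 := h.eq_zero ha' haJ
    rw [← hab, ha0, zero_add]
    exact (mul_comm J (maximalIdeal R)).le hb
  exact Submodule.eq_bot_of_le_maximalIdeal_smul (IsNoetherian.noetherian J) hle

-- The hypothesis `hM` is torsionlessness in pointwise form. If `f a = -f b`, every functional sends
-- this element into `I ⊓ J = ⊥`.
omit [IsNoetherianRing R] in
theorem ker_split (h : IsDecomposition I J) {M : Type*} [AddCommGroup M] [Module R M]
    (hM : ∀ x : M, (∀ φ : M →ₗ[R] R, φ x = 0) → x = 0) {n : ℕ} {f : (Fin n → R) →ₗ[R] M}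
    (hf : IsMinimalCover f) {c : Fin n → R} (hc : f c = 0) :
    ∃ a b, f a = 0 ∧ f b = 0 ∧ (∀ i, a i ∈ I) ∧ (∀ i, b i ∈ J) ∧ a + b = c := by
  have h1 : ∀ i, ∃ a ∈ I, ∃ b ∈ J, a + b = c i := fun i => by
    rw [← Submodule.mem_sup, h.sup_eq]
    exact hf.mem_maximalIdeal c hc i
  choose a ha b hb hab using h1
  have key : ∀ (K : Ideal R) (d : Fin n → R), (∀ i, d i ∈ K) → ∀ φ : M →ₗ[R] R, φ (f d) ∈ K := by
    intro K d hd φ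
    rw [← Finset.univ_sum_single d, map_sum, map_sum]
    refine Submodule.sum_mem _ fun i _ => ?_
    rw [Pi.single_eq_smul_single_one, map_smul, map_smul]
    exact K.mul_mem_right _ (hd i)
  have hab' : a + b = c := funext hab
  have hfab : f a + f b = 0 := by rw [← map_add, hab', hc]
  have hfa : f a = 0 := hM _ fun φ => h.eq_zero (key I a ha φ) (by
    rw [eq_neg_of_add_eq_zero_left hfab, map_neg]
    exact neg_mem (key J b hb φ))
  exact ⟨a, b, hfa, by simpa [hfa] using hfab, ha, hb, hab'⟩

/-- By `ker_split` the one-sided elements generate the kernel; if all lay in `𝔪 • ker f`, Nakayama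
would kill it. -/
theorem exists_generator (h : IsDecomposition I J) {M : Type*} [AddCommGroup M] [Module R M]
    (hM : ∀ x : M, (∀ φ : M →ₗ[R] R, φ x = 0) → x = 0) {n : ℕ} {f : (Fin n → R) →ₗ[R] M}
    (hf : IsMinimalCover f) (hne : LinearMap.ker f ≠ ⊥) :
    ∃ w ∈ LinearMap.ker f, w ∉ maximalIdeal R • LinearMap.ker f ∧
      ((∀ i, w i ∈ I) ∨ (∀ i, w i ∈ J)) := by
  by_contra! H
  apply hne
  refine Submodule.eq_bot_of_le_maximalIdeal_smul (IsNoetherian.noetherian _) fun c hc => ?_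
  obtain ⟨a, b, hfa, hfb, ha, hb, rfl⟩ := h.ker_split hM hf hc
  refine add_mem ?_ ?_
  · by_contra hn
    obtain ⟨i, hi⟩ := (H a hfa hn).1
    exact hi (ha i)
  · by_contra hn
    obtain ⟨i, hi⟩ := (H b hfb hn).2
    exact hi (hb i)

omit [IsNoetherianRing R] in
theorem smul_notMem {M : Type*} [AddCommGroup M] [Module R M]
    {n : ℕ} {f : (Fin n → R) →ₗ[R] M} (hf : IsMinimalCover f)
    {e : Fin n → R} {i : Fin n} (he : IsUnit (e i)) {j : R}
    (hj : j ∉ maximalIdeal R * maximalIdeal R) :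
    j • e ∉ maximalIdeal R • LinearMap.ker f := by
  intro hmem
  have := coord_mem_of_mem_smul (fun c hc => hf.mem_maximalIdeal c hc) hmem i
  rw [Pi.smul_apply, smul_eq_mul] at this
  exact hj ((Ideal.mul_unit_mem_iff_mem _ he).mp this)

/-- A minimal generator killed by `J` yields a minimal generator of the syzygy with coordinates
in `J`. -/
theorem exists_syzygy_generator (h : IsDecomposition I J) {M : Type*} [AddCommGroup M] [Module R M]
    {n : ℕ} {f : (Fin n → R) →ₗ[R] M} (hf : IsMinimalCover f) {w : M}
    (hw : w ∉ maximalIdeal R • (⊤ : Submodule R M)) (hJ : ∀ j ∈ J, j • w = 0) :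
    ∃ u ∈ LinearMap.ker f, u ∉ maximalIdeal R • LinearMap.ker f ∧ ∀ i, u i ∈ J := by
  obtain ⟨j, hj, hj2⟩ := h.exists_notMem_sq
  obtain ⟨e, rfl⟩ := hf.surjective w
  obtain ⟨i, hi⟩ := exists_isUnit_of_map_notMem_smul hw
  exact ⟨j • e, by simp [hJ j hj], smul_notMem hf hi hj2, fun i => J.mul_mem_right _ hj⟩

/-- If a syzygy module has no minimal generator with coordinates in `J`, then it contains no
nonzero element with coordinates in `J`. -/
theorem eq_zero_of_forall_mem_smul (h : IsDecomposition I J) {M : Type*} [AddCommGroup M]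
    [Module R M] (hM : ∀ x : M, (∀ φ : M →ₗ[R] R, φ x = 0) → x = 0) {n : ℕ}
    {f : (Fin n → R) →ₗ[R] M} (hf : IsMinimalCover f)
    (H : ∀ v ∈ LinearMap.ker f, (∀ i, v i ∈ J) → v ∈ maximalIdeal R • LinearMap.ker f)
    {v : Fin n → R} (hv : f v = 0) (hvJ : ∀ i, v i ∈ J) : v = 0 := by
  let C (K : Ideal R) : Submodule R (Fin n → R) :=
    LinearMap.ker f ⊓ Submodule.pi Set.univ fun _ => K
  have hC : ∀ K c, c ∈ C K ↔ f c = 0 ∧ ∀ i, c i ∈ K := by simp [C]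
  have hle : LinearMap.ker f ≤ C I ⊔ C J := by
    intro c hc
    obtain ⟨a, b, hfa, hfb, ha, hb, rfl⟩ := h.ker_split hM hf hc
    exact Submodule.add_mem_sup ((hC _ _).mpr ⟨hfa, ha⟩) ((hC _ _).mpr ⟨hfb, hb⟩)
  have hbot : C J = ⊥ := by
    refine Submodule.eq_bot_of_le_maximalIdeal_smul (IsNoetherian.noetherian _) fun c hc => ?_
    -- Since `𝔪 • ker f ≤ 𝔪 • C I + 𝔪 • C J` and `C I ⊓ C J = ⊥`, the `I`-component of `c` vanishes,
    -- leaving `C J ≤ 𝔪 • C J`.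
    have h1 := Submodule.smul_mono (le_refl (maximalIdeal R)) hle
      (H c ((hC _ _).mp hc).1 ((hC _ _).mp hc).2)
    rw [Submodule.smul_sup] at h1
    obtain ⟨a, ha, b, hb, hab⟩ := Submodule.mem_sup.mp h1
    have haI := (hC _ _).mp (Submodule.smul_le_right ha)
    have hac : a ∈ C J := by
      rw [eq_sub_of_add_eq hab]
      exact sub_mem hc (Submodule.smul_le_right hb)
    have ha0 : a = 0 := funext fun i => h.eq_zero (haI.2 i) (((hC _ _).mp hac).2 i)
    rw [← hab, ha0, zero_add]
    exact hb
  rw [← Submodule.mem_bot R, ← hbot]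
  exact (hC _ _).mpr ⟨hv, hvJ⟩

/-- Two steps after a minimal generator killed by `J`, the syzygy module has minimal generators
with coordinates in either summand of the maximal ideal. -/
theorem exists_second_syzygy_generators (h : IsDecomposition I J)
    (hJ : ∀ j ∈ J, (∀ t ∈ J, t * j = 0 → t = 0) → ¬ J ≤ Ideal.span {j})
    {M : Type*} [AddCommGroup M] [Module R M]
    {n m : ℕ} {f : (Fin n → R) →ₗ[R] M} (hf : IsMinimalCover f) {w : M}
    (hw : w ∉ maximalIdeal R • (⊤ : Submodule R M)) (hwJ : ∀ j ∈ J, j • w = 0)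
    {g : (Fin m → R) →ₗ[R] LinearMap.ker f} (hg : IsMinimalCover g) :
    (∃ u ∈ LinearMap.ker g, u ∉ maximalIdeal R • LinearMap.ker g ∧ ∀ i, u i ∈ I) ∧
    (∃ u ∈ LinearMap.ker g, u ∉ maximalIdeal R • LinearMap.ker g ∧ ∀ i, u i ∈ J) := by
  obtain ⟨j, hj, hj2⟩ := h.exists_notMem_sq
  obtain ⟨e, rfl⟩ := hf.surjective w
  obtain ⟨i, hi⟩ := exists_isUnit_of_map_notMem_smul hw
  have hmem : ∀ t ∈ J, t • e ∈ LinearMap.ker f := fun t ht => by simp [hwJ t ht]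
  have hv : (⟨j • e, hmem j hj⟩ : LinearMap.ker f) ∉ maximalIdeal R • (⊤ : Submodule R _) :=
    Submodule.mk_notMem_smul_top _ (smul_notMem hf hi hj2)
  refine ⟨h.symm.exists_syzygy_generator hg hv fun t ht => Subtype.ext ?_, ?_⟩
  · simp [smul_smul, h.mul_eq_zero ht hj]
  -- Without such a generator, `ker g` has no nonzero element with coordinates in `J`. This makes
  -- `j` a regular generator of `J`, against `hJ`.
  by_contra! H
  have H' : ∀ v ∈ LinearMap.ker g, (∀ i, v i ∈ J) → v ∈ maximalIdeal R • LinearMap.ker g := by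
    intro v hv hvJ
    by_contra hn
    obtain ⟨i, hi⟩ := H v hv hn
    exact hi (hvJ i)
  have hz {v : Fin m → R} (hv : g v = 0) (hvJ : ∀ i, v i ∈ J) : v = 0 := by
    refine h.eq_zero_of_forall_mem_smul (fun x hx => Subtype.ext <| funext fun i => ?_) hg H' hv hvJ
    exact hx (LinearMap.proj i ∘ₗ (LinearMap.ker f).subtype)
  obtain ⟨e₁, he₁⟩ := hg.surjective ⟨j • e, hmem j hj⟩
  rw [← he₁] at hv
  obtain ⟨i₁, hi₁⟩ := exists_isUnit_of_map_notMem_smul hv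
  refine hJ j hj (fun t ht htj => ?_) fun t ht => ?_
  · have : t • e₁ = 0 := hz (by rw [map_smul, he₁]; ext; simp [← mul_assoc, htj])
      fun i => J.mul_mem_right _ ht
    exact (hi₁.mul_left_eq_zero).mp (congrFun this i₁)
  · obtain ⟨e₂, he₂⟩ := hg.surjective ⟨t • e, hmem t ht⟩
    -- Both terms map to `(t * j) • e`. Comparing coordinates at `i₁`, where `e₁` is a unit, shows
    -- that `j` divides `t`.
    have : j • e₂ - t • e₁ = 0 := hz (by
        rw [map_sub, map_smul, map_smul, he₁, he₂]; ext; simp; ring)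
      fun i => sub_mem (J.mul_mem_right _ hj) (J.mul_mem_right _ ht)
    have h2 := congrFun this i₁
    simp only [Pi.sub_apply, Pi.smul_apply, smul_eq_mul, Pi.zero_apply, sub_eq_zero] at h2
    rw [← Ideal.mul_unit_mem_iff_mem _ hi₁, ← h2]
    exact Ideal.mul_mem_right _ _ (Ideal.mem_span_singleton_self j)

omit [IsNoetherianRing R] in
theorem tmul_eq_zero (h : IsDecomposition I J) {n m : ℕ} {u : Fin n → R} {v : Fin m → R}
    (hu : ∀ i, u i ∈ I) (hv : ∀ i, v i ∈ J) : u ⊗ₜ[R] v = 0 := by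
  rw [← Finset.univ_sum_single u, ← Finset.univ_sum_single v, TensorProduct.sum_tmul]
  refine Finset.sum_eq_zero fun i _ => ?_
  rw [TensorProduct.tmul_sum]
  refine Finset.sum_eq_zero fun k _ => ?_
  rw [Pi.single_eq_smul_single_one, Pi.single_eq_smul_single_one k, TensorProduct.smul_tmul_smul, h.mul_eq_zero (hu i) (hv k), zero_smul]

end IsDecomposition

end DecomposableMaximalIdeal

/-! ### Dimension shifting by diagram chases. -/

section TorChases

variable {R : Type*} [CommRing R]
  {A B C D M F Q N : Type*} [AddCommGroup A] [Module R A] [AddCommGroup B] [Module R B]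
  [AddCommGroup C] [Module R C] [AddCommGroup D] [Module R D]
  [AddCommGroup M] [Module R M] [AddCommGroup F] [Module R F]
  [AddCommGroup Q] [Module R Q] [AddCommGroup N] [Module R N]

theorem rTensor_ker_subtype_exact {p : F →ₗ[R] M} (hp : Function.Surjective p) (X : Type*)
    [AddCommGroup X] [Module R X] :
    Function.Exact ((LinearMap.ker p).subtype.rTensor X) (p.rTensor X) :=
  rTensor_exact X (LinearMap.exact_subtype_ker_map p) hp

theorem rTensor_lTensor_comm {X Y Z W : Type*} [AddCommGroup X] [Module R X]
    [AddCommGroup Y] [Module R Y] [AddCommGroup Z] [Module R Z] [AddCommGroup W] [Module R W]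
    (f : X →ₗ[R] Y) (g : Z →ₗ[R] W) (x : X ⊗[R] Z) :
    f.rTensor W (g.lTensor X x) = g.lTensor Y (f.rTensor Z x) := by
  rw [← LinearMap.comp_apply, ← LinearMap.comp_apply, LinearMap.rTensor_comp_lTensor,
    LinearMap.lTensor_comp_rTensor]

/-- Dimension shifting in the first argument: exactness of `M ⊗ A → M ⊗ B → M ⊗ C` passes to the
first syzygy of `M`, one step further along the exact sequence `A → B → C → D`. -/
theorem exact_lTensor_ker [Module.Flat R F] [Module.Flat R C] {a : A →ₗ[R] B} {b : B →ₗ[R] C}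
    {c : C →ₗ[R] D} (hab : Function.Exact a b) (hbc : Function.Exact b c)
    {p : F →ₗ[R] M} (hp : Function.Surjective p)
    (h : Function.Exact (a.lTensor M) (b.lTensor M)) :
    Function.Exact (b.lTensor (LinearMap.ker p)) (c.lTensor (LinearMap.ker p)) := by
  have hinj : Function.Injective ((LinearMap.ker p).subtype.rTensor C) :=
    Module.Flat.rTensor_preserves_injective_linearMap _ (Submodule.injective_subtype _)
  intro z
  constructor
  · intro hz
    obtain ⟨y, hy⟩ := (Module.Flat.lTensor_exact F hbc ((LinearMap.ker p).subtype.rTensor C z)).mp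
      (by rw [← rTensor_lTensor_comm, hz, map_zero])
    obtain ⟨x', hx'⟩ := (h (p.rTensor B y)).mp (by
      rw [← rTensor_lTensor_comm, hy]
      exact (rTensor_ker_subtype_exact hp C).apply_apply_eq_zero z)
    obtain ⟨x, rfl⟩ := LinearMap.rTensor_surjective A hp x'
    obtain ⟨w, hw⟩ := (rTensor_ker_subtype_exact hp B (y - a.lTensor F x)).mp (by
      rw [map_sub, rTensor_lTensor_comm, hx', sub_self])
    refine ⟨w, hinj ?_⟩
    rw [rTensor_lTensor_comm, hw, map_sub, hy,
      (Module.Flat.lTensor_exact F hab).apply_apply_eq_zero, sub_zero]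
  · rintro ⟨y, rfl⟩
    rw [← LinearMap.comp_apply, ← LinearMap.lTensor_comp, hbc.linearMap_comp_eq_zero]
    simp

/-- Exactness of `M ⊗ A → M ⊗ B → M ⊗ C`, where `A → B → C → N → 0` is exact, makes the syzygies
of `M` tensored with `N` inject. -/
theorem injective_rTensor_ker [Module.Flat R F] [Module.Flat R C] {a : A →ₗ[R] B} {b : B →ₗ[R] C}
    {c : C →ₗ[R] N} (hab : Function.Exact a b) (hbc : Function.Exact b c)
    (hc : Function.Surjective c) {p : F →ₗ[R] M} (hp : Function.Surjective p)
    (h : Function.Exact (a.lTensor M) (b.lTensor M)) :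
    Function.Injective ((LinearMap.ker p).subtype.rTensor N) := by
  rw [injective_iff_map_eq_zero]
  intro z hz
  obtain ⟨y, rfl⟩ := LinearMap.lTensor_surjective _ hc z
  have hinj : Function.Injective ((LinearMap.ker p).subtype.rTensor C) :=
    Module.Flat.rTensor_preserves_injective_linearMap _ (Submodule.injective_subtype _)
  rw [rTensor_lTensor_comm] at hz
  obtain ⟨x, hx⟩ := (lTensor_exact F hbc hc _).mp hz
  obtain ⟨t', ht'⟩ := (h (p.rTensor B x)).mp (by
    rw [← rTensor_lTensor_comm, hx]
    exact (rTensor_ker_subtype_exact hp C).apply_apply_eq_zero y)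
  obtain ⟨t, rfl⟩ := LinearMap.rTensor_surjective A hp t'
  obtain ⟨w, hw⟩ := (rTensor_ker_subtype_exact hp B (x - a.lTensor F t)).mp (by
    rw [map_sub, rTensor_lTensor_comm, ht', sub_self])
  have : y = b.lTensor _ w := hinj (by
    rw [rTensor_lTensor_comm, hw, map_sub, hx,
      (Module.Flat.lTensor_exact F hab).apply_apply_eq_zero, sub_zero])
  rw [this]
  exact (lTensor_exact _ hbc hc).apply_apply_eq_zero w

/-- This is the symmetry of `Tor₁`: its vanishing may be tested on a cover of either argument. -/
theorem injective_lTensor_ker [Module.Flat R F] {p : F →ₗ[R] M} (hp : Function.Surjective p)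
    {q : Q →ₗ[R] N} (hq : Function.Surjective q)
    (h : Function.Injective ((LinearMap.ker p).subtype.rTensor N)) :
    Function.Injective ((LinearMap.ker q).subtype.lTensor M) := by
  rw [injective_iff_map_eq_zero]
  intro z hz
  obtain ⟨y, rfl⟩ := LinearMap.rTensor_surjective _ hp z
  have hinj : Function.Injective ((LinearMap.ker q).subtype.lTensor F) :=
    Module.Flat.lTensor_preserves_injective_linearMap _ (Submodule.injective_subtype _)
  rw [← rTensor_lTensor_comm] at hz
  obtain ⟨x, hx⟩ := (rTensor_ker_subtype_exact hp Q _).mp hz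
  obtain ⟨w, hw⟩ := (lTensor_exact _ (LinearMap.exact_subtype_ker_map q) hq x).mp (h (by
    rw [rTensor_lTensor_comm, hx, map_zero]
    exact (lTensor_exact _ (LinearMap.exact_subtype_ker_map q) hq).apply_apply_eq_zero y))
  have : y = (LinearMap.ker p).subtype.rTensor _ w := hinj (by
    rw [← rTensor_lTensor_comm, hw, hx])
  rw [this]
  exact (rTensor_ker_subtype_exact hp _).apply_apply_eq_zero w

end TorChases

/-! ### From vanishing of `Tor₄` to injectivity on syzygies. -/

section Tor

variable {R : Type u} [CommRing R]

theorem exact_lTensor_of_isZero_tor {M N : ModuleCat.{u} R} (P : ProjectiveResolution N) (n : ℕ)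
    (h : Limits.IsZero (((Tor (ModuleCat.{u} R) (n + 1)).obj M).obj N)) :
    Function.Exact ((P.complex.d (n + 2) (n + 1)).hom.lTensor M)
      ((P.complex.d (n + 1) n).hom.lTensor M) := by
  let G := (MonoidalCategory.tensoringLeft (ModuleCat.{u} R)).obj M
  have h1 := h.of_iso (P.isoLeftDerivedObj G (n + 1)).symm
  have h2 : ((G.mapHomologicalComplex _).obj P.complex).ExactAt (n + 1) :=
    (HomologicalComplex.exactAt_iff_isZero_homology _ _).mpr h1
  rw [HomologicalComplex.exactAt_iff' _ (n + 2) (n + 1) n (by simp only [ChainComplex.prev]; rfl)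
    (by simp)] at h2
  have h3 := (ShortComplex.ShortExact.moduleCat_exact_iff_function_exact _).mp h2
  exact h3

/-- If `Tor₄(M, N)` vanishes, then the third syzygy of `M` tensored with the first syzygy of `N`
injects. -/
theorem injective_lTensor_ker_of_isZero_tor {M N : Type u} [AddCommGroup M] [Module R M]
    [AddCommGroup N] [Module R N]
    (h : Limits.IsZero (((Tor (ModuleCat.{u} R) 4).obj (ModuleCat.of R M)).obj
      (ModuleCat.of R N)))
    {F₀ F₁ F₂ F₃ Q : Type*} [AddCommGroup F₀] [Module R F₀] [AddCommGroup F₁] [Module R F₁]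
    [AddCommGroup F₂] [Module R F₂] [AddCommGroup F₃] [Module R F₃] [AddCommGroup Q] [Module R Q]
    [Module.Flat R F₀] [Module.Flat R F₁] [Module.Flat R F₂] [Module.Flat R F₃]
    {f₀ : F₀ →ₗ[R] M} {f₁ : F₁ →ₗ[R] LinearMap.ker f₀} {f₂ : F₂ →ₗ[R] LinearMap.ker f₁}
    {f₃ : F₃ →ₗ[R] LinearMap.ker f₂} {q : Q →ₗ[R] N}
    (h₀ : Function.Surjective f₀) (h₁ : Function.Surjective f₁) (h₂ : Function.Surjective f₂)
    (h₃ : Function.Surjective f₃) (hq : Function.Surjective q) :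
    Function.Injective ((LinearMap.ker q).subtype.lTensor (LinearMap.ker f₂)) := by
  obtain ⟨P⟩ := HasProjectiveResolution.out (Z := ModuleCat.of R N)
  have hex (n : ℕ) : Function.Exact (P.complex.d (n + 2) (n + 1)).hom
      (P.complex.d (n + 1) n).hom :=
    (ShortComplex.ShortExact.moduleCat_exact_iff_function_exact _).mp (P.exact_succ n)
  have hflat (n : ℕ) : Module.Flat R (P.complex.X n) := by
    have := (IsProjective.iff_projective (R := R) (P.complex.X n)).mpr (P.projective n)
    infer_instance
  -- Exactness is at degree 4 of `P`; each syzygy of `M` lowers the degree by one, so `e₃` is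
  -- exactness at degree 1 for `ker f₂`.
  have e₀ := exact_lTensor_of_isZero_tor P 3 h
  have e₁ := exact_lTensor_ker (hex 3) (hex 2) h₀ e₀
  have e₂ := exact_lTensor_ker (hex 2) (hex 1) h₁ e₁
  have e₃ := exact_lTensor_ker (hex 1) (hex 0) h₂ e₂
  have hπ : Function.Exact (P.complex.d 1 0).hom (P.π.f 0).hom :=
    (ShortComplex.ShortExact.moduleCat_exact_iff_function_exact _).mp P.exact₀
  have hπs : Function.Surjective (P.π.f 0).hom := (ModuleCat.epi_iff_surjective _).mp inferInstance
  have e₄ := injective_rTensor_ker (hex 0) hπ hπs h₃ e₃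
  exact injective_lTensor_ker h₃ (N := N) hq e₄

end Tor

/-! ### A criterion for discrete valuation rings. -/

/-- A Noetherian local ring whose maximal ideal is generated by one nonzero element that is a
nonzerodivisor on the maximal ideal is a discrete valuation ring. -/
theorem isDVR_of_maximalIdeal_eq_span {A : Type*} [CommRing A] [IsLocalRing A] [IsNoetherianRing A]
    (hA : ¬ IsField A) {x : A} (hx : maximalIdeal A = Ideal.span {x})
    (hreg : ∀ t ∈ maximalIdeal A, t * x = 0 → t = 0) : IsDVR A := by
  have hx0 : x ≠ 0 := by
    rintro rfl
    exact hA (isField_iff_maximalIdeal_eq.mpr (by simp [hx]))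
  have hreg' : ∀ t, t * x = 0 → t = 0 := by
    intro t ht
    by_cases h : IsUnit t
    · exact absurd ((h.mul_right_eq_zero).mp ht) hx0
    · exact hreg t ((mem_maximalIdeal _).mpr h) ht
  have hpow : ∀ n t, t * x ^ n = 0 → t = 0 := by
    intro n
    induction n with
    | zero => simp
    | succ n ih => exact fun t ht => ih t (hreg' _ (by rw [mul_assoc, ← pow_succ, ht]))
  -- By Krull's intersection theorem `a` lies in `𝔪ⁿ` but not in `𝔪ⁿ⁺¹` for some `n`, so its
  -- cofactor is a unit.
  have hfac : ∀ a : A, a ≠ 0 → ∃ n c, IsUnit c ∧ a = c * x ^ n := by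
    intro a ha
    have hinf : a ∉ ⨅ n : ℕ, maximalIdeal A ^ n := by
      rw [Ideal.iInf_pow_eq_bot_of_isLocalRing _ (maximalIdeal.isMaximal A).ne_top]
      exact ha
    have hex : ∃ n, a ∉ maximalIdeal A ^ n := by simpa [Submodule.mem_iInf] using hinf
    classical
    obtain ⟨n, hn⟩ : ∃ n, Nat.find hex = n + 1 := Nat.exists_eq_succ_of_ne_zero (by
      intro h0
      have := Nat.find_spec hex
      simp [h0] at this)
    have h1 : a ∈ maximalIdeal A ^ n := not_not.mp (Nat.find_min hex (by omega))
    have h2 : a ∉ maximalIdeal A ^ (n + 1) := hn ▸ Nat.find_spec hex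
    rw [hx, Ideal.span_singleton_pow, Ideal.mem_span_singleton'] at h1 h2
    obtain ⟨c, hc⟩ := h1
    refine ⟨n, c, ?_, hc.symm⟩
    by_contra hu
    have : c ∈ maximalIdeal A := (mem_maximalIdeal _).mpr hu
    rw [hx, Ideal.mem_span_singleton'] at this
    obtain ⟨d, rfl⟩ := this
    exact h2 ⟨d, by rw [← hc]; ring⟩
  have hdom : NoZeroDivisors A := by
    refine ⟨fun {a b} hab => ?_⟩
    by_contra! h
    obtain ⟨n, c, hc, rfl⟩ := hfac a h.1
    refine h.2 (hpow n b ((hc.mul_right_eq_zero).mp ?_))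
    rw [← hab]; ring
  have : IsDomain A := NoZeroDivisors.to_isDomain A
  have hprin : (maximalIdeal A).IsPrincipal := ⟨x, hx⟩
  exact ⟨this, ((IsDiscreteValuationRing.TFAE A hA).out 0 4).mpr hprin⟩

/-! ### The vanishing theorem for decomposable maximal ideals. -/

theorem IsTorsionless.eq_zero {A M : Type*} [CommRing A] [AddCommGroup M] [Module A M]
    (h : IsTorsionless A M) (x : M) (hx : ∀ φ : M →ₗ[A] A, φ x = 0) : x = 0 :=
  h (by rw [map_zero]; exact LinearMap.ext hx)

theorem IsMinimalCover.projective_of_ker_eq_bot {R M : Type*} [CommRing R] [IsLocalRing R]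
    [AddCommGroup M] [Module R M] {n : ℕ} {f : (Fin n → R) →ₗ[R] M} (hf : IsMinimalCover f)
    (h : LinearMap.ker f = ⊥) : Module.Projective R M :=
  Module.Projective.of_equiv (LinearEquiv.ofBijective f ⟨LinearMap.ker_eq_bot.mp h, hf.surjective⟩)

theorem projectiveDimension_le_one_of_projective {R M : Type u} [CommRing R] [AddCommGroup M]
    [Module R M] [Module.Projective R M] : projectiveDimension (ModuleCat.of R M) ≤ 1 := by
  have : Projective (ModuleCat.of R M) :=
    (IsProjective.iff_projective (R := R) M).mp inferInstance
  exact (projectiveDimension_le_iff _ 1).mpr inferInstance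

/-- Over a Noetherian local ring with decomposable maximal ideal `I ⊕ J`, where neither `I` nor `J`
is generated by an element that is a nonzerodivisor on it, `Tor₄` of torsionless modules vanishes
only if one of them is projective. -/
theorem IsDecomposition.projective_or_projective {R : Type u} [CommRing R] [IsLocalRing R]
    [IsNoetherianRing R] {I J : Ideal R} (h : IsDecomposition I J)
    (hI : ∀ j ∈ I, (∀ t ∈ I, t * j = 0 → t = 0) → ¬ I ≤ Ideal.span {j})
    (hJ : ∀ j ∈ J, (∀ t ∈ J, t * j = 0 → t = 0) → ¬ J ≤ Ideal.span {j})
    {M N : Type u} [AddCommGroup M] [Module R M] [Module.Finite R M]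
    [AddCommGroup N] [Module R N] [Module.Finite R N]
    (hM : IsTorsionless R M) (hN : IsTorsionless R N)
    (hTor : Limits.IsZero (((Tor (ModuleCat.{u} R) 4).obj (ModuleCat.of R M)).obj
      (ModuleCat.of R N))) :
    Module.Projective R M ∨ Module.Projective R N := by
  obtain ⟨n₀, f₀, h₀⟩ := exists_isMinimalCover R M
  obtain ⟨n₁, f₁, h₁⟩ := exists_isMinimalCover R (LinearMap.ker f₀)
  obtain ⟨n₂, f₂, h₂⟩ := exists_isMinimalCover R (LinearMap.ker f₁)
  obtain ⟨n₃, f₃, h₃⟩ := exists_isMinimalCover R (LinearMap.ker f₂)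
  obtain ⟨m, q, hq⟩ := exists_isMinimalCover R N
  by_cases hK : LinearMap.ker f₀ = ⊥
  · exact Or.inl (h₀.projective_of_ker_eq_bot hK)
  by_cases hL : LinearMap.ker q = ⊥
  · exact Or.inr (hq.projective_of_ker_eq_bot hL)
  exfalso
  obtain ⟨w, hw, hw', hwIJ⟩ := h.exists_generator hM.eq_zero h₀ hK
  have hgen : (∃ u ∈ LinearMap.ker f₂, u ∉ maximalIdeal R • LinearMap.ker f₂ ∧ ∀ i, u i ∈ I) ∧
      (∃ u ∈ LinearMap.ker f₂, u ∉ maximalIdeal R • LinearMap.ker f₂ ∧ ∀ i, u i ∈ J) := by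
    have hw'' := Submodule.mk_notMem_smul_top hw hw'
    -- Coordinates in one summand mean that `w` is killed by the other, so the two cases use `hJ`
    -- and `hI` respectively.
    rcases hwIJ with hwI | hwJ
    · refine h.exists_second_syzygy_generators hJ h₁ hw'' (fun j hj => Subtype.ext ?_) h₂
      exact funext fun i => h.symm.mul_eq_zero hj (hwI i)
    · refine (h.symm.exists_second_syzygy_generators hI h₁ hw''
        (fun j hj => Subtype.ext ?_) h₂).symm
      exact funext fun i => h.mul_eq_zero hj (hwJ i)
  obtain ⟨v, hv, hv', hvIJ⟩ := h.exists_generator hN.eq_zero hq hL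
  obtain ⟨x, hx, hx', hxv⟩ : ∃ x ∈ LinearMap.ker f₂, x ∉ maximalIdeal R • LinearMap.ker f₂ ∧
      x ⊗ₜ[R] v = 0 := by
    -- The generator `x` is taken on the side opposite to `v`.
    rcases hvIJ with hvI | hvJ
    · obtain ⟨x, hx, hx', hxJ⟩ := hgen.2
      exact ⟨x, hx, hx', h.symm.tmul_eq_zero hxJ hvI⟩
    · obtain ⟨x, hx, hx', hxI⟩ := hgen.1
      exact ⟨x, hx, hx', h.tmul_eq_zero hxI hvJ⟩
  have hinj := injective_lTensor_ker_of_isZero_tor hTor h₀.surjective h₁.surjective h₂.surjective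
    h₃.surjective hq.surjective
  have hinj' : Function.Injective ((LinearMap.ker f₂).subtype.rTensor (Fin m → R)) :=
    Module.Flat.rTensor_preserves_injective_linearMap _ (Submodule.injective_subtype _)
  refine tmul_ne_zero_of_notMem_maximalIdeal_smul (Submodule.mk_notMem_smul_top hx hx')
    (Submodule.mk_notMem_smul_top hv hv') (hinj (hinj' ?_))
  simpa using hxv

/-! ### Ring theory of the fiber product. -/

section FiberProduct

variable {S T : Type*} [CommRing S] [CommRing T] {k : Type*} [Field k] {f : S →+* k} {g : T →+* k}

theorem RingHom.pullback_eq (x : f.pullback g) : f x.1.1 = g x.1.2 := x.2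

theorem RingHom.mem_maximalIdeal_iff_eq_zero [IsLocalRing S] (hf : Function.Surjective f) (s : S) :
    s ∈ maximalIdeal S ↔ f s = 0 := by
  rw [← RingHom.mem_ker, eq_maximalIdeal (RingHom.ker_isMaximal_of_surjective f hf)]

theorem RingHom.pullback_mem_maximalIdeal_iff [IsLocalRing S] [IsLocalRing T]
    [IsLocalRing (f.pullback g)] (hf : Function.Surjective f) (hg : Function.Surjective g)
    (x : f.pullback g) : x ∈ maximalIdeal (f.pullback g) ↔ f x.1.1 = 0 := by
  have h : Function.Surjective (f.comp (f.pullbackFst g)) := by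
    intro y
    obtain ⟨s, hs⟩ := hf y
    obtain ⟨t, ht⟩ := hg y
    exact ⟨⟨(s, t), by simp [hs, ht]⟩, hs⟩
  exact RingHom.mem_maximalIdeal_iff_eq_zero h x

/-- By surjectivity, every `R`-submodule of `A` is already an ideal of `A`. -/
theorem isNoetherian_of_surjective_algebraMap {R A : Type*} [CommRing R] [CommRing A] [Algebra R A]
    [IsNoetherianRing A] (h : Function.Surjective (algebraMap R A)) : IsNoetherian R A := by
  refine ⟨fun N => ?_⟩
  let N' : Ideal A :=
    { N with
      smul_mem' := fun a x hx => by
        obtain ⟨r, rfl⟩ := h a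
        rw [algebraMap_smul]
        exact N.smul_mem r hx }
  obtain ⟨s, hs⟩ := IsNoetherian.noetherian N'
  refine ⟨s, ?_⟩
  rw [← Submodule.restrictScalars_span R A h, hs]
  rfl

/-- A ring with two quotient maps to Noetherian rings that are jointly injective is Noetherian. -/
theorem isNoetherianRing_of_ker_inf_ker_eq_bot {R A B : Type*} [CommRing R] [CommRing A]
    [CommRing B] [IsNoetherianRing A] [IsNoetherianRing B] (p : R →+* A) (q : R →+* B)
    (hp : Function.Surjective p) (hq : Function.Surjective q)
    (h : ∀ x, p x = 0 → q x = 0 → x = 0) : IsNoetherianRing R := by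
  let _ := p.toAlgebra
  let _ := q.toAlgebra
  have : IsNoetherian R A := isNoetherian_of_surjective_algebraMap hp
  have : IsNoetherian R B := isNoetherian_of_surjective_algebraMap hq
  refine isNoetherian_of_injective ((Algebra.linearMap R A).prod (Algebra.linearMap R B)) ?_
  rw [injective_iff_map_eq_zero]
  intro x hx
  exact h x (congrArg Prod.fst hx) (congrArg Prod.snd hx)

theorem RingHom.isNoetherianRing_pullback [IsNoetherianRing S] [IsNoetherianRing T]
    (hf : Function.Surjective f) (hg : Function.Surjective g) : IsNoetherianRing (f.pullback g) :=
  isNoetherianRing_of_ker_inf_ker_eq_bot (f.pullbackFst g) (f.pullbackSnd g)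
    (RingHom.surjective_pullbackFst_of_surjective f g hg)
    (RingHom.surjective_pullbackSnd_of_surjective f g hf)
    fun _ h₁ h₂ => Subtype.ext (Prod.ext h₁ h₂)

variable [IsLocalRing S] [IsLocalRing T] [IsLocalRing (f.pullback g)]

theorem RingHom.isDecomposition_pullback (hf : Function.Surjective f)
    (hg : Function.Surjective g) (hS : ¬ IsField S) (hT : ¬ IsField T) :
    IsDecomposition (RingHom.ker (f.pullbackSnd g)) (RingHom.ker (f.pullbackFst g)) where
  inf_eq_bot := by
    rw [eq_bot_iff]
    rintro x ⟨h₂, h₁⟩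
    exact Subtype.ext (Prod.ext h₁ h₂)
  sup_eq := by
    apply le_antisymm
    · refine sup_le (fun x hx => ?_) (fun x hx => ?_)
      · rw [RingHom.pullback_mem_maximalIdeal_iff hf hg, RingHom.pullback_eq]
        exact (congrArg g hx).trans (map_zero g)
      · rw [RingHom.pullback_mem_maximalIdeal_iff hf hg]
        exact (congrArg f hx).trans (map_zero f)
    · intro x hx
      rw [RingHom.pullback_mem_maximalIdeal_iff hf hg] at hx
      have hx' := hx
      rw [RingHom.pullback_eq] at hx'
      have h₁ : ((x.1.1, 0) : S × T) ∈ f.pullback g := hx.trans (map_zero g).symm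
      have h₂ : ((0, x.1.2) : S × T) ∈ f.pullback g := (map_zero f).trans hx'.symm
      have : x = ⟨(x.1.1, 0), h₁⟩ + ⟨(0, x.1.2), h₂⟩ :=
        Subtype.ext (Prod.ext (add_zero _).symm (zero_add _).symm)
      rw [this]
      exact Submodule.add_mem_sup rfl rfl
  left_ne_bot := by
    intro h
    obtain ⟨s, hs, hs0⟩ := Submodule.exists_mem_ne_zero_of_ne_bot
      (mt isField_iff_maximalIdeal_eq.mpr hS)
    rw [RingHom.mem_maximalIdeal_iff_eq_zero hf] at hs
    have hmem : ((s, 0) : S × T) ∈ f.pullback g := hs.trans (map_zero g).symm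
    have : (⟨(s, 0), hmem⟩ : f.pullback g) ∈ RingHom.ker (f.pullbackSnd g) := rfl
    rw [h, Ideal.mem_bot] at this
    exact hs0 (congrArg (f.pullbackFst g) this)
  right_ne_bot := by
    intro h
    obtain ⟨t, ht, ht0⟩ := Submodule.exists_mem_ne_zero_of_ne_bot
      (mt isField_iff_maximalIdeal_eq.mpr hT)
    rw [RingHom.mem_maximalIdeal_iff_eq_zero hg] at ht
    have hmem : ((0, t) : S × T) ∈ f.pullback g := (map_zero f).trans ht.symm
    have : (⟨(0, t), hmem⟩ : f.pullback g) ∈ RingHom.ker (f.pullbackFst g) := rfl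
    rw [h, Ideal.mem_bot] at this
    exact ht0 (congrArg (f.pullbackSnd g) this)

omit [IsLocalRing T] [IsLocalRing (f.pullback g)] in
theorem RingHom.isDVR_of_ker_pullbackSnd_le_span [IsNoetherianRing S] (hf : Function.Surjective f)
    (hS : ¬ IsField S) {x : f.pullback g} (hx : x ∈ RingHom.ker (f.pullbackSnd g))
    (hreg : ∀ t ∈ RingHom.ker (f.pullbackSnd g), t * x = 0 → t = 0)
    (hle : RingHom.ker (f.pullbackSnd g) ≤ Ideal.span {x}) : IsDVR S := by
  have hmem : ∀ s ∈ maximalIdeal S, ((s, 0) : S × T) ∈ f.pullback g := fun s hs =>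
    ((RingHom.mem_maximalIdeal_iff_eq_zero hf s).mp hs).trans (map_zero g).symm
  refine isDVR_of_maximalIdeal_eq_span hS (x := x.1.1) (le_antisymm (fun s hs => ?_) ?_)
    fun s hs h => ?_
  -- Projection to `S` identifies the kernel with `𝔪_S`, carrying both the generator and its
  -- regularity.
  · obtain ⟨c, hc⟩ := Ideal.mem_span_singleton'.mp (hle (show ⟨(s, 0), hmem s hs⟩ ∈ _ from rfl))
    exact Ideal.mem_span_singleton'.mpr ⟨c.1.1, congrArg (f.pullbackFst g) hc⟩
  · rw [Ideal.span_singleton_le_iff_mem, RingHom.mem_maximalIdeal_iff_eq_zero hf,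
      RingHom.pullback_eq]
    exact (congrArg g hx).trans (map_zero g)
  · have := hreg ⟨(s, 0), hmem s hs⟩ rfl (Subtype.ext (Prod.ext h (zero_mul _)))
    exact congrArg (f.pullbackFst g) this

omit [IsLocalRing S] [IsLocalRing (f.pullback g)] in
theorem RingHom.isDVR_of_ker_pullbackFst_le_span [IsNoetherianRing T] (hg : Function.Surjective g)
    (hT : ¬ IsField T) {x : f.pullback g} (hx : x ∈ RingHom.ker (f.pullbackFst g))
    (hreg : ∀ t ∈ RingHom.ker (f.pullbackFst g), t * x = 0 → t = 0)
    (hle : RingHom.ker (f.pullbackFst g) ≤ Ideal.span {x}) : IsDVR T := by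
  have hmem : ∀ t ∈ maximalIdeal T, ((0, t) : S × T) ∈ f.pullback g := fun t ht =>
    (map_zero f).trans ((RingHom.mem_maximalIdeal_iff_eq_zero hg t).mp ht).symm
  refine isDVR_of_maximalIdeal_eq_span hT (x := x.1.2) (le_antisymm (fun t ht => ?_) ?_)
    fun t ht h => ?_
  · obtain ⟨c, hc⟩ := Ideal.mem_span_singleton'.mp (hle (show ⟨(0, t), hmem t ht⟩ ∈ _ from rfl))
    exact Ideal.mem_span_singleton'.mpr ⟨c.1.2, congrArg (f.pullbackSnd g) hc⟩
  · rw [Ideal.span_singleton_le_iff_mem, RingHom.mem_maximalIdeal_iff_eq_zero hg,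
      ← RingHom.pullback_eq]
    exact (congrArg f hx).trans (map_zero f)
  · have := hreg ⟨(0, t), hmem t ht⟩ rfl (Subtype.ext (Prod.ext (zero_mul _) h))
    exact congrArg (f.pullbackSnd g) this

end FiberProduct

theorem mainTheorem7
    {S T : Type u} [CommRing S] [IsLocalRing S] [IsNoetherianRing S]
    [CommRing T] [IsLocalRing T] [IsNoetherianRing T]
    {k : Type v} [Field k] (πS : S →+* k) (πT : T →+* k)
    (hπS : Function.Surjective πS) (hπT : Function.Surjective πT)
    (hS : ¬ IsField S) (hT : ¬ IsField T)
    (hSdvr : ¬ IsDVR S) (hTdvr : ¬ IsDVR T)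
    (M N : Type u) [AddCommGroup M] [Module (πS.pullback πT) M] [Module.Finite (πS.pullback πT) M]
    [AddCommGroup N] [Module (πS.pullback πT) N] [Module.Finite (πS.pullback πT) N]
    (hM : IsTorsionless (πS.pullback πT) M) (hN : IsTorsionless (πS.pullback πT) N)
    (hTor : Limits.IsZero
      (((Tor (ModuleCat.{u} (πS.pullback πT)) 4).obj (ModuleCat.of (πS.pullback πT) M)).obj
        (ModuleCat.of (πS.pullback πT) N))) :
    projectiveDimension (ModuleCat.of (πS.pullback πT) M) ≤ 1 ∨
      projectiveDimension (ModuleCat.of (πS.pullback πT) N) ≤ 1 := by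
  have hloc : IsLocalRing (πS.pullback πT) := by
    have : IsLocalHom πT := .of_surjective πT hπT
    exact RingHom.isLocalRing_pullback πS πT
  have hnoeth := RingHom.isNoetherianRing_pullback hπS hπT
  rcases (RingHom.isDecomposition_pullback hπS hπT hS hT).projective_or_projective
    (fun _ hx hreg hle => hSdvr (RingHom.isDVR_of_ker_pullbackSnd_le_span hπS hS hx hreg hle))
    (fun _ hx hreg hle => hTdvr (RingHom.isDVR_of_ker_pullbackFst_le_span hπT hT hx hreg hle))
    hM hN hTor with h | h
  · exact Or.inl projectiveDimension_le_one_of_projective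
  · exact Or.inr projectiveDimension_le_one_of_projective
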